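/- All rings are associative with an identity, not necessarily commutative. A ring $R$ is *2-primal* if its prime radical $P(R)$ (the intersection of all prime two-sided ideals of $R$) coincides with the set of all nilpotent elements of $R$. A ring $R$ is *strongly 2-nil-clean* if every element of $R$ is the sum of two idempotents and a nilpotent element that commute with one another. An element $e$ of a ring is a *tripotent* if $e^3=e$, and a ring is *trinil clean* if every element of it is the sum of a tripotent and a nilpotent element. **Theorem.** Let $R$ be a 2-primal strongly 2-nil-clean ring. Then the matrix ring $M_n(R)$ is trinil clean for all $n\in\mathbb{N}$; that is, for every $n$, every matrix in $M_n(R)$ is the sum of a tripotent matrix and a nilpotent matrix. -/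

import Mathlib

/-- A (two-sided) ideal `P` of an associative ring with identity is prime if it is proper and,
for all two-sided ideals `I` and `J`, the inclusion `I J ⊆ P` implies `I ⊆ P` or `J ⊆ P`.
Since `P` is closed under addition, `I J ⊆ P` says that all products `x * y` with `x ∈ I`
and `y ∈ J` lie in `P`. -/
def IsPrimeTwoSided {R : Type*} [Ring R] (P : TwoSidedIdeal R) : Prop :=
  P ≠ ⊤ ∧ ∀ I J : TwoSidedIdeal R, (∀ x ∈ I, ∀ y ∈ J, x * y ∈ P) → I ≤ P ∨ J ≤ P

/-- The prime radical of a ring: the intersection of all its prime ideals (the whole ring if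
there are none, that is, for the zero ring). -/
def primeRadical (R : Type*) [Ring R] : TwoSidedIdeal R :=
  sInf {P : TwoSidedIdeal R | IsPrimeTwoSided P}

/-- A ring is 2-primal if its prime radical coincides with its set of nilpotent elements. -/
def IsTwoPrimal (R : Type*) [Ring R] : Prop :=
  (primeRadical R : Set R) = {x : R | IsNilpotent x}

/-- A ring is strongly 2-nil-clean if every element is the sum of two idempotents and a
nilpotent that commute with one another. -/
def IsStronglyTwoNilClean (R : Type*) [Ring R] : Prop :=
  ∀ a : R, ∃ e f w : R, IsIdempotentElem e ∧ IsIdempotentElem f ∧ IsNilpotent w ∧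
    Commute e f ∧ Commute e w ∧ Commute f w ∧ a = e + f + w

/-- An element `e` is a tripotent if `e ^ 3 = e`. -/
def IsTripotent {R : Type*} [Ring R] (e : R) : Prop :=
  e ^ 3 = e

/-- A ring is trinil clean if every element is the sum of a tripotent and a nilpotent. -/
def IsTrinilClean (R : Type*) [Ring R] : Prop :=
  ∀ a : R, ∃ e w : R, IsTripotent e ∧ IsNilpotent w ∧ a = e + w

/-! In `R / P(R)`, whose kernel `P(R)` is the set of nilpotents, nothing nonzero is nilpotent and
every element is a sum of two idempotents. Idempotents of a reduced ring are central, so the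
quotient is commutative, and it satisfies `x ^ 3 = x`. The entries of a matrix over it generate a
finite reduced subring, a product of fields whose elements are `0`, `1`, `-1`. Over such a field,
splitting off cyclic subspaces reduces to companion matrices, which are decomposed explicitly.

To return to `R`, a tripotent is sought in the form `p - q` with `p`, `q` orthogonal idempotents:
such pairs lift modulo nil ideals. The kernel of `M_n(R) → M_n(R / P(R))` is nil because the primes
of `R` control the ideals of `M_n(R)`; this needs the prime radical, not just a nil ideal. -/

/-- An element of a ring that differs by a nilpotent from a difference of two orthogonal
idempotents. -/
def IsOrthoNilClean {T : Type*} [Ring T] (a : T) : Prop :=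
  ∃ p q : T, IsIdempotentElem p ∧ IsIdempotentElem q ∧ p * q = 0 ∧ q * p = 0 ∧
    IsNilpotent (a - (p - q))

/-! ### Transfer along ring maps, and passage to tripotents. -/

namespace IsOrthoNilClean

variable {S T : Type*} [Ring S] [Ring T]

theorem of_isNilpotent {a : T} (ha : IsNilpotent a) : IsOrthoNilClean a :=
  ⟨0, 0, .zero, .zero, by simp, by simp, by simpa using ha⟩

theorem map {a : S} (ha : IsOrthoNilClean a) (f : S →+* T) : IsOrthoNilClean (f a) := by
  obtain ⟨p, q, hp, hq, hpq, hqp, hw⟩ := ha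
  refine ⟨f p, f q, hp.map f, hq.map f, ?_, ?_, ?_⟩
  · rw [← map_mul, hpq, map_zero]
  · rw [← map_mul, hqp, map_zero]
  · simpa using hw.map f

theorem of_map {f : S →+* T} (hf : Function.Surjective f)
    (hker : ∀ x, f x = 0 → IsNilpotent x) {a : S} (ha : IsOrthoNilClean (f a)) :
    IsOrthoNilClean a := by
  obtain ⟨p, q, hp, hq, hpq, hqp, k, hw⟩ := ha
  have he : OrthogonalIdempotents ![p, q] := by
    refine ⟨fun i => ?_, fun i j hij => ?_⟩
    · fin_cases i <;> simpa
    · fin_cases i <;> fin_cases j <;> simp_all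
  -- Orthogonal idempotents lift modulo a nil kernel.
  obtain ⟨e, he, hfe⟩ := he.lift_of_isNilpotent_ker f (fun x hx => hker x hx)
    (fun i => hf _)
  have h0 : f (e 0) = p := congrFun hfe 0
  have h1 : f (e 1) = q := congrFun hfe 1
  refine ⟨e 0, e 1, he.idem 0, he.idem 1, he.ortho (by simp), he.ortho (by simp), ?_⟩
  have hk : IsNilpotent ((a - (e 0 - e 1)) ^ k) := by
    apply hker
    rw [map_pow, map_sub, map_sub, h0, h1, hw]
  exact hk.of_pow

theorem isTrinil {a : T} (ha : IsOrthoNilClean a) :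
    ∃ e w : T, IsTripotent e ∧ IsNilpotent w ∧ a = e + w := by
  obtain ⟨p, q, hp, hq, hpq, hqp, hw⟩ := ha
  refine ⟨p - q, _, ?_, hw, by abel⟩
  have h2 : (p - q) * (p - q) = p + q := by
    simp [mul_sub, sub_mul, hp.eq, hq.eq, hpq, hqp]
  rw [IsTripotent, pow_succ, pow_two, h2]
  simp [mul_sub, add_mul, hp.eq, hq.eq, hpq, hqp]

/-- Over a finite product, the matrix property can be checked on each factor. -/
theorem matrix_pi {ι m : Type*} [Finite ι] [Fintype m] [DecidableEq m] {K : ι → Type*}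
    [∀ i, Ring (K i)] {M : Matrix m m (∀ i, K i)}
    (h : ∀ i, IsOrthoNilClean (M.map (fun x => x i))) : IsOrthoNilClean M := by
  choose p q hp hq hpq hqp hw using h
  have ext' {A B : Matrix m m (∀ i, K i)}
      (hAB : ∀ i, (Pi.evalRingHom K i).mapMatrix A = (Pi.evalRingHom K i).mapMatrix B) :
      A = B := by
    ext a b i
    exact congrFun (congrFun (hAB i) a) b
  have hP (i) : (Pi.evalRingHom K i).mapMatrix (Matrix.of fun a b i => p i a b) = p i := rfl
  have hQ (i) : (Pi.evalRingHom K i).mapMatrix (Matrix.of fun a b i => q i a b) = q i := rfl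
  have hM (i) : (Pi.evalRingHom K i).mapMatrix M = M.map (fun x => x i) := rfl
  refine ⟨Matrix.of fun a b i => p i a b, Matrix.of fun a b i => q i a b,
    ext' fun i => ?_, ext' fun i => ?_, ext' fun i => ?_, ext' fun i => ?_, ?_⟩
  · rw [map_mul, hP, (hp i).eq]
  · rw [map_mul, hQ, (hq i).eq]
  · rw [map_mul, hP, hQ, hpq, map_zero]
  · rw [map_mul, hP, hQ, hqp, map_zero]
  · cases nonempty_fintype ι
    choose k hk using hw
    refine ⟨∑ i, k i, ext' fun i => ?_⟩
    rw [map_pow, map_sub, map_sub, hP, hQ, hM, map_zero]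
    exact pow_eq_zero_of_le (Finset.single_le_sum (fun _ _ => Nat.zero_le _)
      (Finset.mem_univ i)) (hk i)

end IsOrthoNilClean

/-! ### Matrices over the prime radical. -/

section PrimeRadical

variable {T : Type*} [Ring T]

/-- If `a` is not nilpotent, some two-sided ideal is maximal among those containing no power
of `a`. -/
theorem exists_maximal_avoiding_powers {a : T} (ha : ¬ IsNilpotent a) :
    ∃ Q : TwoSidedIdeal T, (∀ k, a ^ k ∉ Q) ∧ ∀ J, Q < J → ∃ k, a ^ k ∈ J := by
  obtain ⟨Q, -, hQ⟩ := zorn_le_nonempty₀ {I : TwoSidedIdeal T | ∀ k, a ^ k ∉ I}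
    (fun c hc hchain y hy => by
      have two {x z : T} (hx : ∃ I ∈ c, x ∈ I) (hz : ∃ I ∈ c, z ∈ I) :
          ∃ I ∈ c, x ∈ I ∧ z ∈ I := by
        obtain ⟨I, hI, hxI⟩ := hx
        obtain ⟨J, hJ, hzJ⟩ := hz
        rcases hchain.total hI hJ with h | h
        · exact ⟨J, hJ, h hxI, hzJ⟩
        · exact ⟨I, hI, hxI, h hzJ⟩
      refine ⟨TwoSidedIdeal.mk' {x | ∃ I ∈ c, x ∈ I} ⟨y, hy, y.zero_mem⟩ ?_ ?_ ?_ ?_, ?_, ?_⟩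
      · intro x z hx hz
        obtain ⟨I, hI, h1, h2⟩ := two hx hz
        exact ⟨I, hI, I.add_mem h1 h2⟩
      · rintro x ⟨I, hI, h⟩
        exact ⟨I, hI, I.neg_mem h⟩
      · rintro x z ⟨I, hI, h⟩
        exact ⟨I, hI, I.mul_mem_left _ _ h⟩
      · rintro x z ⟨I, hI, h⟩
        exact ⟨I, hI, I.mul_mem_right _ _ h⟩
      · intro k hk
        rw [TwoSidedIdeal.mem_mk'] at hk
        obtain ⟨I, hI, h⟩ := hk
        exact hc hI k h
      · intro I hI x hx
        rw [TwoSidedIdeal.mem_mk']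
        exact ⟨I, hI, hx⟩)
    ⊥ (fun k hk => ha ⟨k, (TwoSidedIdeal.mem_bot _).1 hk⟩)
  refine ⟨Q, hQ.prop, fun J hJ => ?_⟩
  by_contra! h
  exact hJ.not_ge (hQ.le_of_ge h hJ.le)

/-- A square matrix with entries in the prime radical is nilpotent. -/
theorem Matrix.isNilpotent_of_mem_primeRadical {m : Type*} [Fintype m] [DecidableEq m]
    {M : Matrix m m T} (hM : ∀ i j, M i j ∈ primeRadical T) : IsNilpotent M := by
  cases isEmpty_or_nonempty m
  · exact ⟨1, Subsingleton.elim _ _⟩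
  by_contra hnil
  obtain ⟨Q, hQ, hmax⟩ := exists_maximal_avoiding_powers hnil
  -- Ideals of the matrix ring are exactly the `M_m(I)`. Maximality of `M_m(I)` makes `I` prime, so
  -- `I` contains the entries of `M`, a contradiction.
  obtain ⟨I, rfl⟩ := (TwoSidedIdeal.orderIsoMatrix (R := T) (n := m)).surjective Q
  have mem (J : TwoSidedIdeal T) (A : Matrix m m T) :
      A ∈ TwoSidedIdeal.orderIsoMatrix J ↔ ∀ i j, A i j ∈ J := TwoSidedIdeal.mem_matrix _ _ _
  suffices hI : IsPrimeTwoSided I by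
    refine hQ 1 ?_
    rw [pow_one, mem]
    exact fun i j => (TwoSidedIdeal.mem_sInf _).1 (hM i j) I hI
  refine ⟨?_, fun J K hJK => ?_⟩
  · rintro rfl
    exact hQ 0 ((mem _ _).2 fun i j => trivial)
  · by_contra! h
    have key (J : TwoSidedIdeal T) (hJ : ¬ J ≤ I) : ∃ k, ∀ i j, (M ^ k) i j ∈ I ⊔ J := by
      obtain ⟨k, hk⟩ := hmax (TwoSidedIdeal.orderIsoMatrix (I ⊔ J))
        ((OrderIso.lt_iff_lt _).2 (left_lt_sup.2 hJ))
      exact ⟨k, (mem _ _).1 hk⟩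
    obtain ⟨a, ha⟩ := key J h.1
    obtain ⟨b, hb⟩ := key K h.2
    refine hQ (a + b) ((mem _ _).2 fun i j => ?_)
    rw [pow_add, Matrix.mul_apply]
    refine sum_mem fun l _ => ?_
    obtain ⟨x, hx, y, hy, hxy⟩ := TwoSidedIdeal.mem_sup.1 (ha i l)
    obtain ⟨z, hz, w, hw, hzw⟩ := TwoSidedIdeal.mem_sup.1 (hb l j)
    rw [← hxy, ← hzw, add_mul, mul_add y]
    exact I.add_mem (I.mul_mem_right _ _ hx)
      (I.add_mem (I.mul_mem_left _ _ hz) (hJK y hy w hw))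

end PrimeRadical

/-! ### Reduced rings of sums of two idempotents. -/

section Reduced

variable {S : Type*} [Ring S] [IsReduced S]

/-- Idempotents of a reduced ring are central. -/
theorem IsIdempotentElem.commute_of_isReduced {e : S} (he : IsIdempotentElem e) (x : S) :
    Commute e x := by
  have h1 : e * x - e * x * e = 0 := by
    refine pow_eq_zero_iff (two_ne_zero) |>.1 ?_
    have : (e * x * (1 - e)) ^ 2 = e * x * ((1 - e) * e) * (x * (1 - e)) := by
      noncomm_ring
    simpa [sub_mul, he.eq, mul_sub] using this
  have h2 : x * e - e * x * e = 0 := by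
    refine pow_eq_zero_iff (two_ne_zero) |>.1 ?_
    have : ((1 - e) * x * e) ^ 2 = (1 - e) * x * (e * (1 - e)) * (x * e) := by
      noncomm_ring
    simpa [sub_mul, he.eq, mul_sub, mul_assoc] using this
  exact (sub_eq_zero.1 h1).trans (sub_eq_zero.1 h2).symm

theorem mul_comm_of_sum_idempotents
    (h : ∀ a : S, ∃ e f : S, IsIdempotentElem e ∧ IsIdempotentElem f ∧ a = e + f)
    (a b : S) : a * b = b * a := by
  obtain ⟨e, f, he, hf, rfl⟩ := h a
  exact (he.commute_of_isReduced b).add_left (hf.commute_of_isReduced b)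

theorem pow_three_of_sum_idempotents
    (h : ∀ a : S, ∃ e f : S, IsIdempotentElem e ∧ IsIdempotentElem f ∧ a = e + f)
    (a : S) : a ^ 3 = a := by
  let _ : CommRing S := { ‹Ring S› with mul_comm := mul_comm_of_sum_idempotents h }
  have key (x : S) : ∃ e f : S, e * e = e ∧ f * f = f ∧ x = e + f := h x
  -- If `-1 = e + f`, squaring `f = -1 - e` gives `4e = -2`; multiplying by `e` gives `6e = 0`, so
  -- `6 = 0`. Then `(e + f)^3 = e + f + 6ef = e + f`.
  have h6 : (6 : S) = 0 := by
    obtain ⟨e, f, he, hf, hx⟩ := key (-1)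
    grind
  obtain ⟨e, f, he, hf, rfl⟩ := key a
  grind

end Reduced

/-! ### Linear algebra over fields with elements `0`, `1`, `-1`. -/

section Field

variable {K V : Type*} [Field K] [AddCommGroup V] [Module K V]

theorem IsOrthoNilClean.of_rank_one {f : Module.End K V} {φ : V →ₗ[K] K} {x : V}
    (hx : φ x = 1 ∨ φ x = -1) (hw : IsNilpotent (f - φ.smulRight x)) : IsOrthoNilClean f := by
  rcases hx with hx | hx
  · exact ⟨φ.smulRight x, 0, by ext; simp [hx], .zero, by simp, by simp, by simpa using hw⟩
  · refine ⟨0, -φ.smulRight x, .zero, ?_, by simp, by simp, by simpa using hw⟩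
    ext; simp [hx]

theorem IsOrthoNilClean.of_rank_two {f : Module.End K V} {φ ψ : V →ₗ[K] K} {x y : V}
    (hφx : φ x = 1) (hφy : φ y = 0) (hψx : ψ x = 0) (hψy : ψ y = -1)
    (hw : IsNilpotent (f - (φ.smulRight x + ψ.smulRight y))) : IsOrthoNilClean f := by
  refine ⟨φ.smulRight x, -ψ.smulRight y, ?_, ?_, ?_, ?_, by simpa using hw⟩ <;>
    ext <;> simp [*]

/-- An endomorphism is nilpotent if it kills a vector under iteration and a basis lies in the
kernel of each power that kills that vector. -/
theorem Module.End.isNilpotent_of_basis {ι : Type*} (b : Module.Basis ι K V)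
    {w : Module.End K V} {v : V} {N : ℕ} (hv : (w ^ N) v = 0)
    (hb : ∀ P : Submodule K V, v ∈ P → (∀ x ∈ P, w x ∈ P) → ∀ i, b i ∈ P) :
    IsNilpotent w := by
  refine ⟨N, b.ext fun i => ?_⟩
  refine hb (LinearMap.ker (w ^ N)) hv (fun x hx => ?_) i
  rw [LinearMap.mem_ker] at hx ⊢
  rw [← Module.End.mul_apply, ← pow_succ, pow_succ', Module.End.mul_apply, hx, map_zero]

/-- An endomorphism with a cyclic vector, over a field all of whose elements are `0`, `1` or
`-1`. -/
theorem IsOrthoNilClean.of_cyclic (hK : ∀ a : K, a = 0 ∨ a = 1 ∨ a = -1)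
    {f : Module.End K V} {v : V} {n : ℕ} (b : Module.Basis (Fin n) K V)
    (hb : ∀ i, b i = (f ^ (i : ℕ)) v) : IsOrthoNilClean f := by
  set e : ℕ → V := fun i => (f ^ i) v with he
  have hfe (i) : f (e i) = e (i + 1) := by
    simp only [he, pow_succ', Module.End.mul_apply]
  have he0 : e 0 = v := by simp [he]
  have hb' (i : Fin n) : b i = e i := hb i
  have hcoord (j : Fin n) (i : ℕ) (hi : i < n) : b.coord j (e i) = if i = j then 1 else 0 := by
    rw [show e i = b ⟨i, hi⟩ from (hb' ⟨i, hi⟩).symm]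
    simp [Finsupp.single_apply, Fin.ext_iff]
  obtain ⟨c, hc⟩ : ∃ c : Fin n → K, e n = ∑ i, c i • e i :=
    ⟨fun i => b.repr (e n) i, by simp only [← hb']; exact (b.sum_repr _).symm⟩
  obtain _ | n := n
  · exact .of_isNilpotent ⟨1, b.ext fun i => i.elim0⟩
  -- The last coefficient is the trace of the companion matrix. If it is `±1`, removing the last
  -- column leaves the nilpotent shift; if it is `0`, a rank-two correction is used.
  by_cases ht : c (Fin.last n) = 0
  swap
  · refine IsOrthoNilClean.of_rank_one (φ := b.coord (Fin.last n)) (x := e (n + 1)) ?_ ?_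
    · have : b.coord (Fin.last n) (e (n + 1)) = c (Fin.last n) := by
        rw [hc, map_sum, Finset.sum_eq_single (Fin.last n)]
        · simp [hcoord]
        · intro i _ hi
          rw [map_smul, hcoord _ _ i.2, if_neg (fun h => hi (Fin.ext h)), smul_zero]
        · simp
      rw [this]
      exact (hK _).resolve_left ht
    · set w := f - (b.coord (Fin.last n)).smulRight (e (n + 1)) with hwdef
      have hw (i) (hi : i < n) : w (e i) = e (i + 1) := by
        have := hcoord (Fin.last n) i (by lia)
        simp [hwdef, -Module.Basis.coord_apply, this, hfe, hi.ne]
      have hwn : w (e n) = 0 := by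
        have := hcoord (Fin.last n) n (by lia)
        simp [hwdef, -Module.Basis.coord_apply, this, hfe]
      have hpow (i) (hi : i ≤ n) : (w ^ i) v = e i := by
        induction i with
        | zero => simp [he0]
        | succ i ih => rw [pow_succ', Module.End.mul_apply, ih (by lia), hw i (by lia)]
      refine Module.End.isNilpotent_of_basis b (v := v) (N := n + 1) ?_ ?_
      · rw [pow_succ', Module.End.mul_apply, hpow n le_rfl, hwn]
      · intro P hv hP i
        rw [hb', ← hpow i (by lia)]
        exact Module.End.pow_apply_mem_of_forall_mem _ hP _ hv
  rw [Fin.sum_univ_castSucc, ht, zero_smul, add_zero] at hc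
  obtain _ | n := n
  · refine .of_isNilpotent ⟨1, b.ext fun i => ?_⟩
    rw [hb', pow_one, show (i : ℕ) = 0 by lia, hfe, hc]
    simp
  rw [Fin.sum_univ_castSucc] at hc
  set β := c (Fin.castSucc (Fin.last n))
  obtain _ | n := n
  · simp only [Finset.univ_eq_empty, Finset.sum_empty, zero_add, Fin.val_castSucc,
      Fin.val_last] at hc
    by_cases hβ : β = 0
    · refine .of_isNilpotent ⟨2, b.ext fun i => ?_⟩
      rw [hβ, zero_smul] at hc
      fin_cases i <;> simp [hb', pow_two, hfe, hc]
    -- This makes `w (e 1) = (β - 2y) e 0 + e 1` equal to `w (e 0) = e 1 - e 0`. The case `β = 0`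
    -- was set aside because `2y = 1` fails in characteristic two.
    obtain ⟨y, hy⟩ : ∃ y : K, 2 * y = β + 1 := by
      rcases (hK β).resolve_left hβ with h | h
      · exact ⟨1, by rw [h]; ring⟩
      · exact ⟨0, by rw [h]; ring⟩
    have h00 := hcoord 0 0 (by simp)
    have h01 := hcoord 0 1 (by simp)
    have h10 := hcoord 1 0 (by simp)
    have h11 := hcoord 1 1 (by simp)
    simp only [Fin.coe_ofNat_eq_mod, Nat.reduceAdd, Nat.reduceMod, if_true, one_ne_zero,
      zero_ne_one, if_false] at h00 h01 h10 h11
    refine IsOrthoNilClean.of_rank_two (φ := b.coord 0 + y • b.coord 1) (ψ := b.coord 1)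
      (x := e 0) (y := y • e 0 - e 1) ?_ ?_ ?_ ?_ ?_
    · simp [-Module.Basis.coord_apply, h00, h10]
    · simp [-Module.Basis.coord_apply, h00, h01, h10, h11]
    · simp [-Module.Basis.coord_apply, h10]
    · simp [-Module.Basis.coord_apply, h10, h11]
    · set w := f - ((b.coord 0 + y • b.coord 1).smulRight (e 0) +
        (b.coord 1).smulRight (y • e 0 - e 1)) with hwdef
      have hw0 : w (e 0) = e 1 - e 0 := by
        simp [hwdef, -Module.Basis.coord_apply, h00, h10, hfe]
      have hw1 : w (e 1) = e 1 - e 0 := by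
        simp only [hwdef, LinearMap.sub_apply, LinearMap.add_apply, LinearMap.smulRight_apply,
          LinearMap.smul_apply, h01, h11, hfe, hc]
        rw [show β = 2 * y - 1 by rw [hy]; ring]
        module
      refine ⟨2, b.ext fun i => ?_⟩
      fin_cases i <;> simp [hb', pow_two, hw0, hw1]
  -- With the `w` below, `w ^ 2` sends `e (n + 1)` to `(α + β + 1) e (n + 1)`, which this choice
  -- kills. Putting `s` into `y` removes it from `w (e (n + 2))`.
  set α : K := -1 - β with hα
  set s : V := ∑ i : Fin (n + 1), c i.castSucc.castSucc • e i.castSucc.castSucc with hs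
  replace hc : e (n + 3) = s + β • e (n + 1) := hc
  obtain ⟨φ, hφ⟩ : ∃ φ : V →ₗ[K] K, ∀ i < n + 3, φ (e i) = if i = n + 1 then 1 else 0 :=
    ⟨b.coord ⟨n + 1, by lia⟩, fun i hi => hcoord ⟨n + 1, by lia⟩ i hi⟩
  obtain ⟨ψ, hψ⟩ : ∃ ψ : V →ₗ[K] K, ∀ i < n + 3, ψ (e i) = if i = n + 2 then 1 else 0 :=
    ⟨b.coord ⟨n + 2, by lia⟩, fun i hi => hcoord ⟨n + 2, by lia⟩ i hi⟩
  have hφs : φ s = 0 := by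
    rw [hs, map_sum]
    refine Finset.sum_eq_zero fun i _ => ?_
    rw [map_smul, hφ _ (by simp; lia), if_neg (by simp; lia), smul_zero]
  have hψs : ψ s = 0 := by
    rw [hs, map_sum]
    refine Finset.sum_eq_zero fun i _ => ?_
    rw [map_smul, hψ _ (by simp; lia), if_neg (by simp; lia), smul_zero]
  have hφ0 := hφ n (by lia)
  have hφ1 := hφ (n + 1) (by lia)
  have hφ2 := hφ (n + 2) (by lia)
  have hψ0 := hψ n (by lia)
  have hψ1 := hψ (n + 1) (by lia)
  have hψ2 := hψ (n + 2) (by lia)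
  simp only [Nat.add_left_cancel_iff, Nat.left_eq_add, if_true, one_ne_zero, OfNat.ofNat_ne_zero,
    OfNat.ofNat_ne_one, OfNat.one_ne_ofNat, if_false] at hφ0 hφ1 hφ2 hψ0 hψ1 hψ2
  refine IsOrthoNilClean.of_rank_two (φ := φ) (ψ := ψ) (x := e (n + 1) - α • e n)
    (y := s - α • e n - e (n + 2)) ?_ ?_ ?_ ?_ ?_
  · simp [hφ0, hφ1]
  · simp [hφ0, hφ2, hφs]
  · simp [hψ0, hψ1]
  · simp [hψ0, hψ2, hψs]
  set w := f - (φ.smulRight (e (n + 1) - α • e n) + ψ.smulRight (s - α • e n - e (n + 2)))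
    with hwdef
  have hw (i) (hi : i < n + 1) : w (e i) = e (i + 1) := by
    simp [hwdef, hφ i (by lia), hψ i (by lia), hi.ne, (show i ≠ n + 2 by lia), hfe]
  have hw1 : w (e (n + 1)) = e (n + 2) - e (n + 1) + α • e n := by
    simp only [hwdef, LinearMap.sub_apply, LinearMap.add_apply, LinearMap.smulRight_apply,
      hφ1, hψ1, hfe]
    module
  have hw2 : w (e (n + 2)) = e (n + 2) + β • e (n + 1) + α • e n := by
    simp only [hwdef, LinearMap.sub_apply, LinearMap.add_apply, LinearMap.smulRight_apply,
      hφ2, hψ2, hfe, hc]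
    module
  have hpow (i) (hi : i ≤ n + 1) : (w ^ i) v = e i := by
    induction i with
    | zero => simp [he0]
    | succ i ih => rw [pow_succ', Module.End.mul_apply, ih (by lia), hw i (by lia)]
  refine Module.End.isNilpotent_of_basis b (v := v) (N := n + 3) ?_ ?_
  · rw [pow_succ', Module.End.mul_apply, pow_succ', Module.End.mul_apply, hpow _ le_rfl, hw1,
      map_add, map_sub, map_smul, hw1, hw2, hw n (by lia), hα]
    module
  · intro P hv hP i
    have hlow (i) (hi : i ≤ n + 1) : e i ∈ P := by
      rw [← hpow i hi]
      exact Module.End.pow_apply_mem_of_forall_mem _ hP _ hv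
    rw [hb']
    rcases Nat.lt_or_ge i (n + 2) with hi | hi
    · exact hlow i (by lia)
    -- So `v` is cyclic for `w` too: the last basis vector is recovered from the next iterate.
    · have h2 : e (n + 2) = w (e (n + 1)) + e (n + 1) - α • e n := by rw [hw1]; module
      rw [show (i : ℕ) = n + 2 by lia, h2]
      exact P.sub_mem (P.add_mem (hP _ (hlow _ le_rfl)) (hlow _ le_rfl))
        (P.smul_mem _ (hlow n (by lia)))

/-- Gluing along an invariant subspace with a complement: if the compression to the subspace
and to the complement both are differences of orthogonal idempotents up to a nilpotent, then so
is the endomorphism. -/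
theorem IsOrthoNilClean.of_invariant {U U' : Submodule K V} (h : IsCompl U U')
    {f : Module.End K V} (hf : ∀ x ∈ U, f x ∈ U)
    (h1 : IsOrthoNilClean (f.restrict hf : Module.End K U))
    (h2 : IsOrthoNilClean (U'.projectionOnto U h.symm ∘ₗ f ∘ₗ U'.subtype : Module.End K U')) :
    IsOrthoNilClean f := by
  obtain ⟨p, q, hp, hq, hpq, hqp, a, hw⟩ := h1
  obtain ⟨p', q', hp', hq', hpq', hqp', a', hw'⟩ := h2
  set π := U.projectionOnto U' h with hπ
  set π' := U'.projectionOnto U h.symm with hπ'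
  have e1 (x : U) : π x = x := Submodule.projectionOnto_apply_left h x
  have e2 (x : U') : π x = 0 := Submodule.projectionOnto_apply_right h x
  have e3 (x : U') : π' x = x := Submodule.projectionOnto_apply_left h.symm x
  have e4 (x : U) : π' x = 0 := Submodule.projectionOnto_apply_right h.symm x
  let glue (g : Module.End K U) (g' : Module.End K U') : Module.End K V :=
    U.subtype ∘ₗ g ∘ₗ π + U'.subtype ∘ₗ g' ∘ₗ π'
  have glue_apply (g g' x) : glue g g' x = g (π x) + g' (π' x) := rfl
  have glue_mul (g g' k k') : glue g g' * glue k k' = glue (g * k) (g' * k') := by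
    ext x
    simp [glue_apply, e1, e2, e3, e4]
  have glue_zero : glue 0 0 = 0 := by ext x; simp [glue_apply]
  refine ⟨glue p p', glue q q', ?_, ?_, ?_, ?_, ?_⟩
  · rw [IsIdempotentElem, glue_mul, hp.eq, hp'.eq]
  · rw [IsIdempotentElem, glue_mul, hq.eq, hq'.eq]
  · rw [glue_mul, hpq, hpq', glue_zero]
  · rw [glue_mul, hqp, hqp', glue_zero]
  set w := f - (glue p p' - glue q q') with hwdef
  set u := f.restrict hf - (p - q) with hu
  set u' := π' ∘ₗ f ∘ₗ U'.subtype - (p' - q') with hu'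
  have hsum (x : V) : (π x : V) + π' x = x := by
    have := Submodule.projection_add_projection_eq_self h x
    simpa [← Submodule.coe_projectionOnto_apply] using this
  have hwU (x : U) : w x = u x := by
    simp [hwdef, hu, glue_apply, e1, e4]
  have hwU' (x : V) : π' (w x) = u' (π' x) := by
    have h3 : π' (f x) = π' (f (π' x)) := by
      conv_lhs => rw [← hsum x, map_add, map_add]
      rw [show π' (f (π x)) = 0 from e4 ⟨_, hf _ (π x).2⟩, zero_add]
    simp [hwdef, hu', glue_apply, e3, e4, h3]
  have pow1 (k) (x : U) : (w ^ k) x = (u ^ k) x := by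
    induction k with
    | zero => simp
    | succ k ih => rw [pow_succ', Module.End.mul_apply, ih, hwU, pow_succ', Module.End.mul_apply]
  have pow2 (k) (x : V) : π' ((w ^ k) x) = (u' ^ k) (π' x) := by
    induction k with
    | zero => simp
    | succ k ih => rw [pow_succ', Module.End.mul_apply, hwU', ih, pow_succ', Module.End.mul_apply]
  -- `w ^ a'` maps into `U`, where `w` acts as `u`, and `u ^ a = 0`.
  refine ⟨a + a', LinearMap.ext fun x => ?_⟩
  have h0 := hsum ((w ^ a') x)
  rw [pow2, hw', LinearMap.zero_apply, Submodule.coe_zero, add_zero] at h0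
  rw [pow_add, Module.End.mul_apply, ← h0, pow1, hw]
  simp

/-- Every vector generates an invariant subspace with basis its first iterates. -/
theorem Module.End.exists_cyclic_basis [FiniteDimensional K V] (f : Module.End K V) (v : V) :
    ∃ (U : Submodule K V) (hf : ∀ x ∈ U, f x ∈ U) (hvU : v ∈ U) (n : ℕ)
      (b : Module.Basis (Fin n) K U), ∀ i, b i = ((f.restrict hf) ^ (i : ℕ)) ⟨v, hvU⟩ := by
  classical
  let P (n : ℕ) : Prop := ¬ LinearIndependent K (fun i : Fin (n + 1) => (f ^ (i : ℕ)) v)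
  have hP : ∃ n, P n := ⟨Module.finrank K V, fun h => by
    have := h.fintype_card_le_finrank
    simp at this⟩
  -- `P n` concerns `n + 1` vectors, so for the least `n` the first `n` iterates are independent and
  -- span the next one.
  obtain ⟨n, hn, hmin⟩ : ∃ n, P n ∧ ∀ m < n, ¬ P m :=
    ⟨Nat.find hP, Nat.find_spec hP, fun m => Nat.find_min hP⟩
  have hli : LinearIndependent K (fun i : Fin n => (f ^ (i : ℕ)) v) := by
    cases n with
    | zero => exact linearIndependent_empty_type
    | succ n => exact not_not.1 (hmin n n.lt_succ_self)
  have hmem : (f ^ n) v ∈ Submodule.span K (Set.range fun i : Fin n => (f ^ (i : ℕ)) v) := by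
    by_contra hcon
    exact hn (linearIndependent_finSucc'.2 ⟨hli, hcon⟩)
  set U := Submodule.span K (Set.range fun i : Fin n => (f ^ (i : ℕ)) v) with hU
  have hiter (i : ℕ) (hi : i ≤ n) : (f ^ i) v ∈ U := by
    rcases hi.eq_or_lt with rfl | hi
    · exact hmem
    · exact Submodule.subset_span ⟨⟨i, hi⟩, rfl⟩
  have hf : ∀ x ∈ U, f x ∈ U := by
    intro x hx
    have : U ≤ U.comap f := by
      rw [hU, Submodule.span_le]
      rintro _ ⟨i, rfl⟩
      have := hiter (i + 1) i.2
      rwa [pow_succ', Module.End.mul_apply] at this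
    exact this hx
  refine ⟨U, hf, by simpa using hiter 0 n.zero_le, n, Module.Basis.span hli, fun i => ?_⟩
  apply Subtype.ext
  rw [Module.Basis.span_apply, Module.End.pow_restrict, LinearMap.coe_restrict_apply]

/-- A nonzero vector generates a nonzero cyclic subspace, so its complement has smaller dimension.
The complement need not be invariant; the compression to it suffices for the induction. -/
theorem Module.End.isOrthoNilClean [FiniteDimensional K V]
    (hK : ∀ a : K, a = 0 ∨ a = 1 ∨ a = -1) (f : Module.End K V) : IsOrthoNilClean f := by
  induction hd : Module.finrank K V using Nat.strong_induction_on generalizing V with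
  | _ d ih =>
    cases subsingleton_or_nontrivial V
    · exact .of_isNilpotent ⟨1, Subsingleton.elim _ _⟩
    obtain ⟨v, hv⟩ := exists_ne (0 : V)
    obtain ⟨U, hf, hvU, n, b, hb⟩ := f.exists_cyclic_basis v
    obtain ⟨U', h⟩ := U.exists_isCompl
    refine .of_invariant h hf (.of_cyclic hK b hb) (ih (Module.finrank K U') ?_ _ rfl)
    have hpos : 0 < Module.finrank K U :=
      Module.finrank_pos_iff_exists_ne_zero.2 ⟨⟨v, hvU⟩, by simpa using hv⟩
    have := Submodule.finrank_add_eq_of_isCompl h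
    lia

end Field

/-! ### Reduction to fields and conclusion. -/

/-- Every square matrix over a commutative ring in which `x ^ 3 = x` holds is a difference of
orthogonal idempotents up to a nilpotent. -/
theorem Matrix.isOrthoNilClean {S : Type*} [CommRing S] (hS : ∀ x : S, x ^ 3 = x) {m : Type*}
    [Fintype m] [DecidableEq m] (M : Matrix m m S) : IsOrthoNilClean M := by
  -- `A` is finitely generated over `ℤ` by integrality and killed by `6 = 2 ^ 3 - 2`, hence finite;
  -- being also reduced, it is a finite product of fields.
  let A := Algebra.adjoin ℤ (Set.range fun ij : m × m => M ij.1 ij.2)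
  have hA (x : A) : x ^ 3 = x := Subtype.ext (hS x)
  have : Module.Finite ℤ A := 
    Algebra.finite_adjoin_of_finite_of_isIntegral (Set.finite_range _) fun x _ =>
      ⟨Polynomial.X ^ 3 - Polynomial.X, by monicity!, by simp [hS]⟩
  have h6 : (6 : A) = 0 := by linear_combination hA 2
  have : Finite A := Module.finite_of_fg_torsion A fun {x} =>
    ⟨⟨6, by simp⟩, by
      change (6 : ℤ) • x = 0
      rw [zsmul_eq_mul]
      push_cast
      rw [h6, zero_mul]⟩
  have : IsReduced A := ⟨fun x ⟨k, hk⟩ => by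
    have hodd (j : ℕ) : x ^ (2 * j + 1) = x := by
      induction j with
      | zero => simp
      | succ j ih => rw [show 2 * (j + 1) + 1 = 2 * j + 1 + 2 by ring, pow_add, ih,
          ← pow_succ', hA]
    rw [← hodd k]
    exact pow_eq_zero_of_le (by lia) hk⟩
  let N : Matrix m m A := .of fun i j => ⟨M i j, Algebra.subset_adjoin ⟨(i, j), rfl⟩⟩
  suffices hN : IsOrthoNilClean N from hN.map A.val.toRingHom.mapMatrix
  let e := IsArtinianRing.equivPi A
  have he : e.symm.toAlgHom.toRingHom.mapMatrix (e.toAlgHom.toRingHom.mapMatrix N) = N := by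
    ext; simp
  rw [← he]
  refine IsOrthoNilClean.map (.matrix_pi fun I => ?_) _
  let _ := Ideal.Quotient.field I.asIdeal
  have hK (a : A ⧸ I.asIdeal) : a = 0 ∨ a = 1 ∨ a = -1 := by
    obtain ⟨a, rfl⟩ := Ideal.Quotient.mk_surjective a
    have h3 := congrArg (Ideal.Quotient.mk I.asIdeal) (hA a)
    rw [map_pow] at h3
    generalize Ideal.Quotient.mk I.asIdeal a = t at h3
    have : t * ((t - 1) * (t + 1)) = 0 := by linear_combination h3
    simpa [sub_eq_zero, eq_neg_iff_add_eq_zero] using this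
  have := (Module.End.isOrthoNilClean hK (Matrix.toLin'
    ((e.toAlgHom.toRingHom.mapMatrix N).map (fun x => x I)))).map
      (LinearMap.toMatrixAlgEquiv' (R := A ⧸ I.asIdeal) (n := m)).toRingEquiv.toRingHom
  convert this using 1
  exact (LinearMap.toMatrix'_toLin' _).symm

/-- Modulo a surjection whose kernel is the set of nilpotent elements, a strongly 2-nil-clean ring
becomes commutative with `x ^ 3 = x`. -/
theorem IsStronglyTwoNilClean.isOrthoNilClean_map {R S : Type*} [Ring R] [Ring S]
    (hclean : IsStronglyTwoNilClean R) {π : R →+* S} (hsurj : Function.Surjective π)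
    (hπ : ∀ x, π x = 0 ↔ IsNilpotent x) {m : Type*} [Fintype m] [DecidableEq m]
    (M : Matrix m m S) : IsOrthoNilClean M := by
  have : IsReduced S := ⟨fun s ⟨k, hk⟩ => by
    obtain ⟨x, rfl⟩ := hsurj s
    rw [← map_pow, hπ] at hk
    exact (hπ x).2 hk.of_pow⟩
  have hsum (s : S) : ∃ e f : S, IsIdempotentElem e ∧ IsIdempotentElem f ∧ s = e + f := by
    obtain ⟨x, rfl⟩ := hsurj s
    obtain ⟨e, f, w, he, hf, hw, -, -, -, rfl⟩ := hclean x
    exact ⟨π e, π f, he.map π, hf.map π, by rw [map_add, map_add, (hπ w).2 hw, add_zero]⟩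
  have hcube := pow_three_of_sum_idempotents hsum
  let _ : CommRing S := { ‹Ring S› with mul_comm := mul_comm_of_sum_idempotents hsum }
  exact Matrix.isOrthoNilClean hcube M

theorem theorem4p4 {R : Type*} [Ring R] (h2primal : IsTwoPrimal R)
    (hclean : IsStronglyTwoNilClean R) (n : ℕ) :
    IsTrinilClean (Matrix (Fin n) (Fin n) R) := by
  have hnil (x : R) : x ∈ primeRadical R ↔ IsNilpotent x := Set.ext_iff.1 h2primal x
  obtain ⟨S, _, π, hsurj, hπ⟩ : ∃ (S : Type _) (_ : Ring S) (π : R →+* S),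
      Function.Surjective π ∧ ∀ x, π x = 0 ↔ IsNilpotent x :=
    ⟨_, inferInstance, (primeRadical R).ringCon.mk', RingCon.mk'_surjective _, fun x => by
      rw [← hnil, ← TwoSidedIdeal.mem_ker, TwoSidedIdeal.ker_ringCon_mk']⟩
  intro M
  refine (IsOrthoNilClean.of_map (f := π.mapMatrix) (fun A => ?_) (fun A hA => ?_)
    (hclean.isOrthoNilClean_map hsurj hπ _)).isTrinil
  · choose g hg using hsurj
    exact ⟨A.map g, by ext; simp [hg]⟩
  · refine Matrix.isNilpotent_of_mem_primeRadical fun i j => ?_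
    rw [hnil, ← hπ]
    exact congrFun (congrFun hA i) j
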